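/- Boolean algebras. For Boolean algebras $A,B$ and $U\subseteq A$, a map $f:U\to B$ is called $2$-preserving if for all $a,b\in U$ (possibly equal), $a\cdot b=0$ implies $f(a)\cdot f(b)=0$. A Boolean algebra $A$ is $2$-free if there is a subset $X\subseteq A$ such that for every nontrivial Boolean algebra $B$, every $2$-preserving map $X\to B$ extends to a unique homomorphism $A\to B$. Let $\mathrm{FinCo}(\omega_1)$ be the algebra of finite and cofinite subsets of $\omega_1$, and $\mathrm{Fr}(\omega_1)$ the free Boolean algebra on $\omega_1$ generators, realized as the algebra of subsets of the Cantor space $\{0,1\}^{\omega_1}$ generated by the sets $\{f : f(\alpha)=1\}$, $\alpha<\omega_1$. Spaces. The dual space of a Boolean algebra is its space of ultrafilters with the Stone topology. A topological space is supercompact if it has an open subbase such that every cover of the space by members of the subbase has a subcover with at most two members. For a loopless undirected graph $G$ with vertex set $V$, the clique graph space of $G$ is the subspace of $\{0,1\}^V$ (with the product of the discrete topologies) consisting of the characteristic functions of cliques of $G$; a graph space is a space homeomorphic to the clique graph space of some such graph. Theorem. The algebras $\mathrm{FinCo}(\omega_1)$ and $\mathrm{Fr}(\omega_1)$ are both $2$-free,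 but their product $\mathrm{FinCo}(\omega_1)\times\mathrm{Fr}(\omega_1)$ is not $2$-free; so a product of two $2$-free Boolean algebras need not be $2$-free. Moreover, the dual space of $\mathrm{FinCo}(\omega_1)\times\mathrm{Fr}(\omega_1)$ is supercompact but is not a graph space. -/

import Mathlib

open scoped Ordinal

universe u v

/-- A map `f : U → B` on a subset `U` of a Boolean algebra `A` is `n`-preserving if
`a₀ ⋯ aₙ₋₁ = 0` implies `f a₀ ⋯ f aₙ₋₁ = 0` for all `a₀, …, aₙ₋₁ ∈ U` (repetitions allowed). -/
def IsNPreserving {A : Type u} {B : Type v} [BooleanAlgebra A] [BooleanAlgebra B]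
    (n : ℕ) {U : Set A} (f : U → B) : Prop :=
  ∀ a : Fin n → U,
    (Finset.univ.inf fun i => (a i : A)) = ⊥ → (Finset.univ.inf fun i => f (a i)) = ⊥

/-- `A` is `n`-free over `X` if every `n`-preserving map from `X` to a nontrivial Boolean algebra
extends to a unique homomorphism of Boolean algebras on `A`. -/
def IsNFreeOver (n : ℕ) (A : Type u) [BooleanAlgebra A] (X : Set A) : Prop :=
  ∀ (B : Type v) [BooleanAlgebra B] [Nontrivial B] (f : X → B), IsNPreserving n f →
    ∃! g : BoundedLatticeHom A B, ∀ x : X, g x = f x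

/-- `A` is `n`-free (`n ≥ 1`) if it is `n`-free over some subset. -/
def IsNFree (n : ℕ) (A : Type u) [BooleanAlgebra A] : Prop :=
  ∃ X : Set A, IsNFreeOver.{u, v} n A X

/-- The algebra of finite and cofinite subsets of `κ`. -/
def FinCo (κ : Type u) : BooleanSubalgebra (Set κ) where
  carrier := {s | s.Finite ∨ sᶜ.Finite}
  supClosed' := by
    rintro s hs t ht
    simp only [Set.mem_ofPred_eq, Set.sup_eq_union, Set.compl_union] at *
    rcases hs with hs | hs
    · rcases ht with ht | ht
      · exact Or.inl (hs.union ht)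
      · exact Or.inr (ht.subset Set.inter_subset_right)
    · exact Or.inr (hs.subset Set.inter_subset_left)
  infClosed' := by
    rintro s hs t ht
    simp only [Set.mem_ofPred_eq, Set.inf_eq_inter, Set.compl_inter] at *
    rcases hs with hs | hs
    · exact Or.inl (hs.subset Set.inter_subset_left)
    · rcases ht with ht | ht
      · exact Or.inl (ht.subset Set.inter_subset_right)
      · exact Or.inr (hs.union ht)
  compl_mem' := by
    intro s hs
    simpa only [Set.mem_ofPred_eq, compl_compl] using hs.symm
  bot_mem' := Or.inl Set.finite_empty

/-- The free Boolean algebra on `κ`: the algebra of subsets of the Cantor space `2^κ` generated by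
the independent family of the sets `{f | f i = 1}`, `i : κ`. -/
def Fr (κ : Type u) : BooleanSubalgebra (Set (κ → Bool)) :=
  BooleanSubalgebra.closure (Set.range fun i : κ => {f : κ → Bool | f i = true})

/-- An ultrafilter of a Boolean algebra. -/
@[ext]
structure Ult (A : Type u) [BooleanAlgebra A] where
  carrier : Set A
  top_mem : ⊤ ∈ carrier
  bot_notMem : ⊥ ∉ carrier
  inf_mem : ∀ a ∈ carrier, ∀ b ∈ carrier, a ⊓ b ∈ carrier
  mem_of_le : ∀ a ∈ carrier, ∀ b, a ≤ b → b ∈ carrier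
  mem_or_compl_mem : ∀ a, a ∈ carrier ∨ aᶜ ∈ carrier

/-- The Stone topology: the sets of all ultrafilters containing a given element of the algebra
form a base (they are closed under finite intersections). -/
instance (A : Type u) [BooleanAlgebra A] : TopologicalSpace (Ult A) :=
  TopologicalSpace.generateFrom (Set.range fun a : A => {p : Ult A | a ∈ p.carrier})

/-- A space is supercompact if it has an open subbase such that every cover by members of the
subbase has a subcover with at most two members. -/
def IsSupercompact (T : Type u) [t : TopologicalSpace T] : Prop :=
  ∃ S : Set (Set T), t = TopologicalSpace.generateFrom S ∧
    ∀ C ⊆ S, ⋃₀ C = Set.univ → ∃ D ⊆ C, D.encard ≤ 2 ∧ ⋃₀ D = Set.univ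

/-- The set of (characteristic functions of) cliques of a graph. As a subspace of the product
`V → Bool` of discrete spaces it is the clique graph space of `G`. -/
def cliqueSpace {V : Type v} (G : SimpleGraph V) : Set (V → Bool) :=
  {f | G.IsClique {x | f x = true}}

/-- A graph space is a space homeomorphic to the clique graph space of some (loopless) graph. -/
def IsGraphSpace (T : Type u) [TopologicalSpace T] : Prop :=
  ∃ (V : Type v) (G : SimpleGraph V), Nonempty (T ≃ₜ cliqueSpace G)

/-! Call a generating set `X` two-generating if every pairwise meeting subset of `X` is exactly the
trace of an ultrafilter. By Stone duality this gives 2-freeness. It holds for the singletons in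
`FinCo κ` (distinct ones are disjoint) and for the free generators of `Fr κ` (they are independent).
Moreover `X` together with its complements is then binary, and binary families of two algebras
combine to one of the product, so the dual space of the product is supercompact.

Conversely, a 2-free algebra with compact dual has a graph space as its dual: ultrafilters
correspond to cliques of the "meets" graph on the nonzero generators. So it remains to see that the
disjoint sum of a Cantor cube and a one-point compactification, both over an uncountable `κ`, is not
a graph space (`not_homeomorph_cliqueSpace`). Subsets of cliques are cliques, so near the empty
clique lies every clique with a fixed finite vertex set `F` removed. If the empty clique is in the
cube, then so are the isolated points with `F` removed; a measure argument
(`exists_infinite_mem_of_isOpen`) finds one clique of the cube containing infinitely many of these,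
and their union contradicts isolation. If it is in the compactification, removing `F` injects the
cube, up to finite data, into a set of size `κ`. -/

namespace Ult

/-! ### Ultrafilters and Stone duality. -/

variable {A : Type u} {B : Type v} [BooleanAlgebra A] [BooleanAlgebra B]

lemma compl_mem_iff (p : Ult A) {a : A} : aᶜ ∈ p.carrier ↔ a ∉ p.carrier := by
  refine ⟨fun h h' => p.bot_notMem ?_, fun h => (p.mem_or_compl_mem a).resolve_left h⟩
  simpa using p.inf_mem _ h' _ h

lemma inf_mem_iff (p : Ult A) {a b : A} :
    a ⊓ b ∈ p.carrier ↔ a ∈ p.carrier ∧ b ∈ p.carrier :=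
  ⟨fun h => ⟨p.mem_of_le _ h _ inf_le_left, p.mem_of_le _ h _ inf_le_right⟩,
    fun h => p.inf_mem _ h.1 _ h.2⟩

lemma sup_mem_iff (p : Ult A) {a b : A} :
    a ⊔ b ∈ p.carrier ↔ a ∈ p.carrier ∨ b ∈ p.carrier := by
  have h := p.compl_mem_iff (a := aᶜ ⊓ bᶜ)
  rw [compl_inf, compl_compl, compl_compl] at h
  rw [h, inf_mem_iff, compl_mem_iff, compl_mem_iff]
  tauto

lemma eq_of_subset {p q : Ult A} (h : p.carrier ⊆ q.carrier) : p = q := by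
  ext a
  refine ⟨fun ha => h ha, fun ha => ?_⟩
  by_contra hn
  exact q.compl_mem_iff.1 (h (p.compl_mem_iff.2 hn)) ha

/-- The ultrafilter induced on `A` along a homomorphism `A → B`. -/
def comap (g : BoundedLatticeHom A B) (q : Ult B) : Ult A where
  carrier := {a | g a ∈ q.carrier}
  top_mem := by simpa using q.top_mem
  bot_notMem := by simpa using q.bot_notMem
  inf_mem a ha b hb := by simpa using q.inf_mem _ ha _ hb
  mem_of_le a ha b hab := q.mem_of_le _ ha _ (OrderHomClass.mono g hab)
  mem_or_compl_mem a := by simpa using q.mem_or_compl_mem (g a)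

@[simp] lemma mem_comap {g : BoundedLatticeHom A B} {q : Ult B} {a : A} :
    a ∈ (comap g q).carrier ↔ g a ∈ q.carrier := Iff.rfl

/-- An ultrafilter on a type, as an ultrafilter of the power set algebra. -/
def ofUltrafilter {α : Type u} (F : Ultrafilter α) : Ult (Set α) where
  carrier := {s | s ∈ F}
  top_mem := Filter.univ_mem
  bot_notMem := F.empty_notMem
  inf_mem _ ha _ hb := Filter.inter_mem ha hb
  mem_of_le _ ha _ h := Filter.mem_of_superset ha h
  mem_or_compl_mem := F.mem_or_compl_mem

@[simp] lemma mem_ofUltrafilter {α : Type u} {F : Ultrafilter α} {s : Set α} :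
    s ∈ (ofUltrafilter F).carrier ↔ s ∈ F := Iff.rfl

/-- An ultrafilter as a homomorphism into the two-element algebra of subsets of a point. -/
def toHom (p : Ult A) : BoundedLatticeHom A (Set PUnit.{v + 1}) where
  toFun a := {_x | a ∈ p.carrier}
  map_sup' a b := by ext; simp [sup_mem_iff]
  map_inf' a b := by ext; simp [inf_mem_iff]
  map_top' := by ext; simp [p.top_mem]
  map_bot' := by ext; simp [p.bot_notMem]

lemma mem_toHom (p : Ult A) (a : A) (x : PUnit.{v + 1}) :
    x ∈ (toHom p : A → Set PUnit.{v + 1}) a ↔ a ∈ p.carrier := Iff.rfl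

lemma exists_mem {b : A} (hb : b ≠ ⊥) : ∃ q : Ult A, b ∈ q.carrier := by
  have hd : Disjoint ((Order.PFilter.principal b : Order.PFilter A) : Set A)
      ((Order.Ideal.principal ⊥ : Order.Ideal A) : Set A) := by
    rw [Set.disjoint_left]
    intro x hx hx'
    have h1 : b ≤ x := by simpa using hx
    have h2 : x = ⊥ := le_bot_iff.1 (Order.Ideal.mem_principal.1 hx')
    exact hb (le_bot_iff.1 (h2 ▸ h1))
  obtain ⟨J, hJ, -, hJd⟩ := DistribLattice.prime_ideal_of_disjoint_filter_ideal hd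
  have hbJ : b ∉ J := fun h => Set.disjoint_left.1 hJd (by simp) h
  refine ⟨⟨{x | x ∉ J}, fun h => hbJ (J.lower le_top h), fun h => h J.bot_mem, ?_, ?_, ?_⟩, hbJ⟩
  · intro x hx y hy h
    exact (hJ.mem_or_mem h).elim hx hy
  · intro x hx y hxy hy
    exact hx (J.lower hxy hy)
  · intro x
    by_contra! h
    simp only [Set.mem_ofPred_eq, not_not] at h
    have h1 : x ⊔ xᶜ ∈ J := J.sup_mem h.1 h.2
    rw [sup_compl_eq_top] at h1
    exact hbJ (J.lower le_top h1)

lemma le_of_forall {a b : A} (h : ∀ q : Ult A, a ∈ q.carrier → b ∈ q.carrier) : a ≤ b := by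
  by_contra hab
  obtain ⟨q, hq⟩ := exists_mem (b := a ⊓ bᶜ) (fun h0 => hab (by
    rw [← sdiff_eq, sdiff_eq_bot_iff] at h0; exact h0))
  rw [inf_mem_iff, compl_mem_iff] at hq
  exact hq.2 (h q hq.1)

lemma eq_of_forall {a b : A} (h : ∀ q : Ult A, a ∈ q.carrier ↔ b ∈ q.carrier) : a = b :=
  le_antisymm (le_of_forall fun q => (h q).1) (le_of_forall fun q => (h q).2)

lemma isOpen_mem (a : A) : IsOpen {p : Ult A | a ∈ p.carrier} :=
  TopologicalSpace.isOpen_generateFrom_of_mem ⟨a, rfl⟩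

lemma isOpen_notMem (a : A) : IsOpen {p : Ult A | a ∉ p.carrier} := by
  simpa only [compl_mem_iff] using isOpen_mem aᶜ

lemma ext_of_closure {X : Set A} (hX : BooleanSubalgebra.closure X = ⊤) {p q : Ult A}
    (h : ∀ x ∈ X, x ∈ p.carrier ↔ x ∈ q.carrier) : p = q := by
  ext a
  have ha : a ∈ BooleanSubalgebra.closure X := hX ▸ BooleanSubalgebra.mem_top
  induction ha using BooleanSubalgebra.closure_bot_sup_induction with
  | mem x hx => exact h x hx
  | bot => simp [p.bot_notMem, q.bot_notMem]
  | sup x _ y _ hx hy => simp [sup_mem_iff, hx, hy]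
  | compl x _ hx => simp [compl_mem_iff, hx]

end Ult

/-! ### Two-generating sets, 2-freeness and graph spaces. -/

section TwoFree

variable {A : Type u} [BooleanAlgebra A]

lemma isNPreserving_two_iff {B : Type v} [BooleanAlgebra B] {U : Set A} {f : U → B} :
    IsNPreserving 2 f ↔ ∀ x y : U, (x : A) ⊓ y = ⊥ → f x ⊓ f y = ⊥ := by
  refine ⟨fun h x y hxy => ?_, fun h a ha => ?_⟩
  · simpa [Fin.univ_succ] using h ![x, y] (by simpa [Fin.univ_succ] using hxy)
  · simpa [Fin.univ_succ] using h (a 0) (a 1) (by simpa [Fin.univ_succ] using ha)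

/-- `X` generates `A`, and every pairwise meeting subset of `X` is the trace on `X` of an
ultrafilter. -/
def IsTwoGenerating (X : Set A) : Prop :=
  BooleanSubalgebra.closure X = ⊤ ∧
    ∀ K ⊆ X, (∀ a ∈ K, ∀ b ∈ K, a ⊓ b ≠ ⊥) → ∃ p : Ult A, ∀ x ∈ X, x ∈ p.carrier ↔ x ∈ K

/-- A homomorphism is dual to a map of ultrafilters. For an ultrafilter `q` of `B` the generators
that `f` sends into `q` pairwise meet, so they determine an ultrafilter `P q` of `A`; the extension
of `f` is the dual of `P`. -/
theorem IsTwoGenerating.isNFreeOver {X : Set A} (hX : IsTwoGenerating X) :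
    IsNFreeOver.{u, v} 2 A X := by
  intro B _ _ f hf
  rw [isNPreserving_two_iff] at hf
  have key (q : Ult B) : ∃ p : Ult A, ∀ x : X, (x : A) ∈ p.carrier ↔ f x ∈ q.carrier := by
    obtain ⟨p, hp⟩ := hX.2 {a | ∃ h : a ∈ X, f ⟨a, h⟩ ∈ q.carrier} (fun a ha => ha.1) (by
      rintro a ⟨ha, ha'⟩ b ⟨hb, hb'⟩ hab
      have := q.inf_mem _ ha' _ hb'
      rw [hf ⟨a, ha⟩ ⟨b, hb⟩ hab] at this
      exact q.bot_notMem this)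
    refine ⟨p, fun x => (hp x x.2).trans ⟨fun h => h.2, fun h => ⟨x.2, h⟩⟩⟩
  choose P hP using key
  -- Continuity of `P`: preimages of basic clopen sets are basic clopen, which need only be checked
  -- on generators.
  have ex (a : A) : ∃ b : B, ∀ q, b ∈ q.carrier ↔ a ∈ (P q).carrier := by
    have ha : a ∈ BooleanSubalgebra.closure X := hX.1 ▸ BooleanSubalgebra.mem_top
    induction ha using BooleanSubalgebra.closure_bot_sup_induction with
    | mem x hx => exact ⟨f ⟨x, hx⟩, fun q => (hP q ⟨x, hx⟩).symm⟩
    | bot => exact ⟨⊥, fun q => by simp [Ult.bot_notMem]⟩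
    | sup x _ y _ hx hy =>
      obtain ⟨b, hb⟩ := hx
      obtain ⟨c, hc⟩ := hy
      exact ⟨b ⊔ c, fun q => by simp [Ult.sup_mem_iff, hb, hc]⟩
    | compl x _ hx =>
      obtain ⟨b, hb⟩ := hx
      exact ⟨bᶜ, fun q => by simp [Ult.compl_mem_iff, hb]⟩
  choose g hg using ex
  refine ⟨⟨⟨⟨g, fun a b => ?_⟩, fun a b => ?_⟩, ?_, ?_⟩, fun x => ?_, fun g' hg' => ?_⟩
  · exact Ult.eq_of_forall fun q => by simp [hg, Ult.sup_mem_iff]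
  · exact Ult.eq_of_forall fun q => by simp [hg, Ult.inf_mem_iff]
  · exact Ult.eq_of_forall fun q => by simp [hg, Ult.top_mem]
  · exact Ult.eq_of_forall fun q => by simp [hg, Ult.bot_notMem]
  · exact Ult.eq_of_forall fun q => by rw [← hP q x]; exact hg x q
  · ext a
    change g' a = g a
    refine Ult.eq_of_forall fun q => ?_
    rw [hg]
    have : Ult.comap g' q = P q := Ult.ext_of_closure hX.1 fun x hx => by
      rw [Ult.mem_comap, hg' ⟨x, hx⟩, hP q ⟨x, hx⟩]
    rw [← this, Ult.mem_comap]

theorem IsNFree.isGraphSpace [CompactSpace (Ult A)] (h : IsNFree.{u, v} 2 A) :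
    IsGraphSpace.{u, u} (Ult A) := by
  classical
  obtain ⟨X, hX⟩ := h
  -- `⊥` must be left out: as a vertex it would form a one-element clique, but no ultrafilter
  -- contains it.
  let V := {x : A // x ∈ X ∧ x ≠ ⊥}
  let G : SimpleGraph V :=
    { Adj := fun x y => x ≠ y ∧ (x : A) ⊓ y ≠ ⊥
      symm := ⟨fun x y h => ⟨h.1.symm, by rw [inf_comm]; exact h.2⟩⟩
      loopless := ⟨fun x h => h.1 rfl⟩ }
  refine ⟨V, G, ⟨?_⟩⟩
  let F : Ult A → cliqueSpace G := fun p => ⟨fun x => decide ((x : A) ∈ p.carrier), by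
    intro x hx y hy hxy
    simp only [Set.mem_ofPred_eq, decide_eq_true_eq] at hx hy
    refine ⟨hxy, fun h0 => p.bot_notMem ?_⟩
    rw [← h0]
    exact p.inf_mem _ hx _ hy⟩
  have hF : Continuous F := by
    refine Continuous.subtype_mk (continuous_pi fun x => ?_) _
    refine (continuous_bool_rng true).2 ?_
    have : (fun p : Ult A => decide ((x : A) ∈ p.carrier)) ⁻¹' {true} =
        {p | (x : A) ∈ p.carrier} := by ext; simp
    rw [this]
    exact ⟨⟨Ult.isOpen_notMem _⟩, Ult.isOpen_mem _⟩
  have ext_set : ∀ {s t : Set PUnit.{v + 1}}, (PUnit.unit ∈ s ↔ PUnit.unit ∈ t) → s = t := by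
    intro s t h
    ext ⟨⟩
    exact h
  -- Test the universal property on the two-element algebra: uniqueness of extensions gives
  -- injectivity, existence gives surjectivity.
  have hbij : Function.Bijective F := by
    constructor
    · intro p q hpq
      have hmem : ∀ x ∈ X, x ∈ p.carrier ↔ x ∈ q.carrier := by
        intro x hx
        by_cases h0 : x = ⊥
        · simp [h0, Ult.bot_notMem]
        · have := congrFun (congrArg Subtype.val hpq) ⟨x, hx, h0⟩
          simpa [F] using this
      obtain ⟨g, -, hg⟩ := hX (Set PUnit.{v + 1}) (fun x => p.toHom x) (by
        rw [isNPreserving_two_iff]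
        intro x y hxy
        rw [← map_inf, hxy, map_bot])
      have hpq' : p.toHom = q.toHom := (hg _ fun x => rfl).trans
        (hg _ fun x => ext_set (by rw [Ult.mem_toHom, Ult.mem_toHom, hmem x x.2])).symm
      ext a
      rw [← Ult.mem_toHom p a PUnit.unit, hpq', Ult.mem_toHom]
    · intro K
      obtain ⟨g, hg, -⟩ := hX (Set PUnit.{v + 1})
        (fun x => {_z | ∃ h : (x : A) ≠ ⊥, K.1 ⟨x, x.2, h⟩ = true}) (by
        rw [isNPreserving_two_iff]
        intro x y hxy
        refine Set.eq_empty_iff_forall_notMem.2 ?_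
        rintro z ⟨⟨hx, hx'⟩, hy, hy'⟩
        by_cases hne : x = y
        · subst hne
          exact hx (by simpa using hxy)
        · refine (K.2 hx' hy' ?_).2 hxy
          intro h
          exact hne (Subtype.ext (congrArg (fun z : V => (z : A)) h)))
      refine ⟨Ult.comap g (Ult.ofUltrafilter (pure PUnit.unit)), Subtype.ext (funext fun x => ?_)⟩
      have h1 : PUnit.unit ∈ g x ↔ ∃ h : (x : A) ≠ ⊥, K.1 ⟨x, x.2.1, h⟩ = true := by
        rw [hg ⟨x, x.2.1⟩]; rfl
      have h2 : PUnit.unit ∈ g x ↔ K.1 x = true :=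
        h1.trans ⟨fun h => h.2, fun h => ⟨x.2.2, h⟩⟩
      simp [F, h2]
  exact Continuous.homeoOfEquivCompactToT2 (f := Equiv.ofBijective F hbij) hF

end TwoFree

/-! ### Binary families and supercompactness. -/

/-- Every pairwise meeting subset of `Y` extends to an ultrafilter. -/
def IsBinary {A : Type u} [BooleanAlgebra A] (Y : Set A) : Prop :=
  ∀ P ⊆ Y, (∀ a ∈ P, ∀ b ∈ P, a ⊓ b ≠ ⊥) → ∃ p : Ult A, P ⊆ p.carrier

section
variable {A : Type u} {B : Type v} [BooleanAlgebra A] [BooleanAlgebra B]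

lemma IsTwoGenerating.isBinary {X : Set A} (hX : IsTwoGenerating X) :
    IsBinary (X ∪ compl '' X) := by
  intro P hP hP'
  obtain ⟨p, hp⟩ := hX.2 (P ∩ X) Set.inter_subset_right
    fun a ha b hb => hP' a ha.1 b hb.1
  refine ⟨p, fun a ha => ?_⟩
  rcases hP ha with haX | ⟨x, hx, rfl⟩
  · exact (hp a haX).2 ⟨ha, haX⟩
  · rw [p.compl_mem_iff, hp x hx]
    exact fun h => hP' x h.1 _ ha inf_compl_eq_bot

lemma IsBinary.insert_top {Y : Set A} (hY : IsBinary Y) : IsBinary (insert ⊤ Y) := by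
  intro P hP hP'
  obtain ⟨p, hp⟩ := hY (P ∩ Y) Set.inter_subset_right fun a ha b hb => hP' a ha.1 b hb.1
  refine ⟨p, fun a ha => ?_⟩
  rcases hP ha with rfl | h
  · exact p.top_mem
  · exact hp ⟨ha, h⟩

@[simp] lemma Prod.mk_compl_mk (a : A) (b : B) : (a, b)ᶜ = (aᶜ, bᶜ) := rfl

/-- The first projection of a product of Boolean algebras as a homomorphism. -/
def BoundedLatticeHom.prodFst : BoundedLatticeHom (A × B) A where
  toFun := Prod.fst
  map_sup' _ _ := rfl
  map_inf' _ _ := rfl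
  map_top' := rfl
  map_bot' := rfl

/-- The second projection of a product of Boolean algebras as a homomorphism. -/
def BoundedLatticeHom.prodSnd : BoundedLatticeHom (A × B) B where
  toFun := Prod.snd
  map_sup' _ _ := rfl
  map_inf' _ _ := rfl
  map_top' := rfl
  map_bot' := rfl

@[simp] lemma BoundedLatticeHom.prodFst_apply (x : A × B) :
    (prodFst : BoundedLatticeHom (A × B) A) x = x.1 := rfl

@[simp] lemma BoundedLatticeHom.prodSnd_apply (x : A × B) :
    (prodSnd : BoundedLatticeHom (A × B) B) x = x.2 := rfl

/-- Elements supported on different factors never meet, so a pairwise meeting family lives on a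
single factor. -/
lemma IsBinary.prod {Y : Set A} {Z : Set B} (hY : IsBinary Y) (hZ : IsBinary Z) :
    IsBinary ((fun a => (a, (⊥ : B))) '' Y ∪ (fun b => ((⊥ : A), b)) '' Z) := by
  intro P hP hP'
  by_cases hl : ∃ a ∈ Y, (a, ⊥) ∈ P
  · obtain ⟨a, -, haP⟩ := hl
    obtain ⟨p, hp⟩ := hY {a ∈ Y | (a, ⊥) ∈ P} (Set.sep_subset _ _) (by
      rintro a ⟨-, ha⟩ b ⟨-, hb⟩ hab
      exact hP' _ ha _ hb (Prod.ext hab (by simp)))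
    refine ⟨p.comap BoundedLatticeHom.prodFst, fun x hx => ?_⟩
    rcases hP hx with ⟨y, hy, rfl⟩ | ⟨z, -, rfl⟩
    · exact hp ⟨hy, hx⟩
    · exact (hP' _ haP _ hx (Prod.ext (by simp) (by simp))).elim
  · obtain ⟨p, hp⟩ := hZ {b ∈ Z | (⊥, b) ∈ P} (Set.sep_subset _ _) (by
      rintro a ⟨-, ha⟩ b ⟨-, hb⟩ hab
      exact hP' _ ha _ hb (Prod.ext (by simp) hab))
    refine ⟨p.comap BoundedLatticeHom.prodSnd, fun x hx => ?_⟩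
    rcases hP hx with ⟨y, hy, rfl⟩ | ⟨z, hz, rfl⟩
    · exact (hl ⟨y, hy, hx⟩).elim
    · exact hp ⟨hz, hx⟩

/-- The subbase consists of the sets of ultrafilters omitting some `y ∈ Y`. If no two members of a
cover suffice, the corresponding `y` pairwise meet, and an ultrafilter containing all of them is
left uncovered. -/
lemma IsBinary.isSupercompact {Y : Set A} (hY : IsBinary Y)
    (htop : ∀ a : A, @IsOpen _ (TopologicalSpace.generateFrom
      ((fun y : A => {p : Ult A | y ∉ p.carrier}) '' Y)) {p : Ult A | a ∈ p.carrier}) :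
    IsSupercompact (Ult A) := by
  refine ⟨(fun y : A => {p : Ult A | y ∉ p.carrier}) '' Y, le_antisymm ?_ ?_, ?_⟩
  · refine le_generateFrom ?_
    rintro _ ⟨y, -, rfl⟩
    exact Ult.isOpen_notMem y
  · refine le_generateFrom ?_
    rintro _ ⟨a, rfl⟩
    exact htop a
  · intro C hC hcov
    by_contra! hno
    obtain ⟨p, hp⟩ := hY {y ∈ Y | {p : Ult A | y ∉ p.carrier} ∈ C} (Set.sep_subset _ _) (by
      rintro a ⟨-, ha⟩ b ⟨-, hb⟩ hab
      refine hno {{p | a ∉ p.carrier}, {p | b ∉ p.carrier}} ?_ ((Set.encard_insert_le _ _).trans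
        (by rw [Set.encard_singleton]; norm_num)) ?_
      · rintro _ (rfl | rfl) <;> assumption
      · refine Set.eq_univ_of_forall fun p => ?_
        have := p.bot_notMem
        rw [← hab, p.inf_mem_iff] at this
        simpa [imp_iff_not_or] using this)
    obtain ⟨s, hs, hps⟩ : p ∈ ⋃₀ C := hcov ▸ Set.mem_univ p
    obtain ⟨y, hy, rfl⟩ := hC hs
    exact hps (hp ⟨hy, hs⟩)

end

theorem IsTwoGenerating.isSupercompact_prod {A B : Type u} [BooleanAlgebra A] [BooleanAlgebra B]
    {X : Set A} {Z : Set B} (hX : IsTwoGenerating X) (hZ : IsTwoGenerating Z) :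
    IsSupercompact (Ult (A × B)) := by
  refine (hX.isBinary.insert_top.prod hZ.isBinary.insert_top).isSupercompact ?_
  generalize ht : TopologicalSpace.generateFrom _ = t
  -- The elements whose Stone set is clopen in the topology generated by the subbase; the goal is
  -- that these are all.
  let L : BooleanSubalgebra (A × B) :=
    { carrier := {a | @IsOpen _ t {p : Ult (A × B) | a ∈ p.carrier} ∧
        @IsOpen _ t {p : Ult (A × B) | a ∉ p.carrier}}
      supClosed' := by
        rintro a ⟨ha, ha'⟩ b ⟨hb, hb'⟩
        simp only [Set.mem_ofPred_eq, Ult.sup_mem_iff, not_or]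
        exact ⟨ha.union hb, ha'.inter hb'⟩
      infClosed' := by
        rintro a ⟨ha, ha'⟩ b ⟨hb, hb'⟩
        simp only [Set.mem_ofPred_eq, Ult.inf_mem_iff, not_and_or]
        exact ⟨ha.inter hb, ha'.union hb'⟩
      compl_mem' := by
        rintro a ⟨ha, ha'⟩
        simp only [Set.mem_ofPred_eq, Ult.compl_mem_iff, not_not]
        exact ⟨ha', ha⟩
      bot_mem' := by simp [Ult.bot_notMem] }
  have hopen_left : ∀ a ∈ insert ⊤ (X ∪ compl '' X),
      @IsOpen _ t {p : Ult (A × B) | (a, (⊥ : B)) ∉ p.carrier} := fun a ha =>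
    ht ▸ TopologicalSpace.isOpen_generateFrom_of_mem ⟨_, Or.inl ⟨a, ha, rfl⟩, rfl⟩
  have hopen_right : ∀ b ∈ insert ⊤ (Z ∪ compl '' Z),
      @IsOpen _ t {p : Ult (A × B) | ((⊥ : A), b) ∉ p.carrier} := fun b hb =>
    ht ▸ TopologicalSpace.isOpen_generateFrom_of_mem ⟨_, Or.inr ⟨b, hb, rfl⟩, rfl⟩
  -- Here the added `⊤` is used: it puts both summands of the dual space into the subbase.
  have hL_left : ((⊤ : A), (⊥ : B)) ∈ L := by
    refine ⟨?_, hopen_left _ (Or.inl rfl)⟩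
    convert hopen_right ⊤ (Or.inl rfl) using 3
    rw [← Ult.compl_mem_iff]
    simp
  have hL_right : ((⊥ : A), (⊤ : B)) ∈ L := by
    simpa using L.compl_mem hL_left
  have gen_left : ∀ a : A, (a, (⊥ : B)) ∈ L := by
    intro a
    have ha : a ∈ BooleanSubalgebra.closure X := hX.1 ▸ BooleanSubalgebra.mem_top
    induction ha using BooleanSubalgebra.closure_bot_sup_induction with
    | mem x hx =>
      refine ⟨?_, hopen_left x (by simp [hx])⟩
      have h1 := (hopen_left xᶜ (by simp [hx])).inter hL_right.2
      convert h1 using 1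
      ext p
      simp only [Set.mem_inter_iff, Set.mem_ofPred_eq]
      rw [← not_or, ← Ult.sup_mem_iff, ← Ult.compl_mem_iff]
      simp
    | bot => exact L.bot_mem
    | sup x _ y _ hx hy => simpa using L.sup_mem hx hy
    | compl x _ hx => simpa using L.inf_mem (L.compl_mem hx) hL_left
  have gen_right : ∀ b : B, ((⊥ : A), b) ∈ L := by
    intro b
    have hb : b ∈ BooleanSubalgebra.closure Z := hZ.1 ▸ BooleanSubalgebra.mem_top
    induction hb using BooleanSubalgebra.closure_bot_sup_induction with
    | mem x hx =>
      refine ⟨?_, hopen_right x (by simp [hx])⟩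
      have h1 := (hopen_right xᶜ (by simp [hx])).inter hL_left.2
      convert h1 using 1
      ext p
      simp only [Set.mem_inter_iff, Set.mem_ofPred_eq]
      rw [← not_or, ← Ult.sup_mem_iff, ← Ult.compl_mem_iff]
      simp
    | bot => exact L.bot_mem
    | sup x _ y _ hx hy => simpa using L.sup_mem hx hy
    | compl x _ hx => simpa using L.inf_mem (L.compl_mem hx) hL_right
  intro x
  have := L.sup_mem (gen_left x.1) (gen_right x.2)
  simp only [Prod.mk_sup_mk, sup_bot_eq, bot_sup_eq] at this
  exact this.1

theorem IsSupercompact.compactSpace {T : Type u} [TopologicalSpace T] (h : IsSupercompact T) :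
    CompactSpace T := by
  obtain ⟨S, hS, hS'⟩ := h
  refine ⟨isCompact_generateFrom hS fun P hP hcov => ?_⟩
  obtain ⟨D, hD, hcard, hDcov⟩ := hS' P hP (Set.univ_subset_iff.1 hcov)
  exact ⟨D, hD, Set.finite_of_encard_le_coe (k := 2) hcard, hDcov.ge⟩

/-! ### Uncountable families of open sets in a Cantor cube. -/

lemma exists_finset_of_isOpen_pi_bool {κ : Type u} {U : Set (κ → Bool)} (hU : IsOpen U)
    {f : κ → Bool} (hf : f ∈ U) : ∃ F : Finset κ, ∀ g, (∀ k ∈ F, g k = f k) → g ∈ U := by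
  obtain ⟨F, w, hw, hF⟩ := isOpen_pi_iff.1 hU f hf
  refine ⟨F, fun g hg => hF ?_⟩
  intro k hk
  rw [hg k hk]
  exact (hw k hk).2

lemma exists_not_countable_fiber {ι : Type u} {β : Type v} [Uncountable ι] [Countable β]
    (f : ι → β) : ∃ b, ¬ (f ⁻¹' {b}).Countable := by
  by_contra! h
  have := Set.countable_iUnion h
  rw [← Set.preimage_iUnion, Set.iUnion_of_singleton, Set.preimage_univ] at this
  exact Set.not_countable_univ this

-- Shrink the sets to cylinders. Infinitely many of these fix the same number `n` of coordinates, so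
-- have measure `2⁻ⁿ` for fair coin tossing; by continuity from above their limsup has measure at
-- least `2⁻ⁿ` and is nonempty.
open MeasureTheory in
lemma exists_infinite_mem_of_isOpen {κ : Type u} {ι : Type v} [Uncountable ι]
    (U : ι → Set (κ → Bool)) (hU : ∀ i, IsOpen (U i)) (hne : ∀ i, (U i).Nonempty) :
    ∃ f, {i | f ∈ U i}.Infinite := by
  classical
  choose f hf using hne
  choose F hF using fun i => exists_finset_of_isOpen_pi_bool (hU i) (hf i)
  obtain ⟨n, hn⟩ := exists_not_countable_fiber fun i => (F i).card
  have hinf : ((fun i => (F i).card) ⁻¹' {n}).Infinite := fun h => hn h.countable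
  let e := hinf.natEmbedding
  let μ : Measure (κ → Bool) :=
    Measure.infinitePi fun _ : κ => (PMF.uniformOfFintype Bool).toMeasure
  let C : ℕ → Set (κ → Bool) := fun m => Set.pi (F (e m)) fun k => {f (e m) k}
  have hC : ∀ m, μ (C m) = (2⁻¹ : ENNReal) ^ n := by
    intro m
    have : (F (e m)).card = n := (e m).2
    simp only [μ, C]
    rw [Measure.infinitePi_pi _ (fun _ _ => measurableSet_singleton _)]
    simp [this]
  have hCm : ∀ m, MeasurableSet (C m) := fun m =>
    MeasurableSet.pi (F (e m)).countable_toSet fun _ _ => measurableSet_singleton _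
  have hlim : (⋂ N, ⋃ m ≥ N, C m).Nonempty := by
    refine nonempty_of_measure_ne_zero (μ := μ) ?_
    have anti : Antitone fun N => ⋃ m ≥ N, C m := fun a b hab =>
      Set.biUnion_subset_biUnion_left fun m hm => le_trans hab hm
    rw [anti.measure_iInter (fun N => (MeasurableSet.biUnion (Set.to_countable _)
      fun m _ => hCm m).nullMeasurableSet) ⟨0, measure_ne_top _ _⟩]
    refine (lt_of_lt_of_le (b := (2⁻¹ : ENNReal) ^ n) ?_ (le_iInf fun N => ?_)).ne'
    · exact ENNReal.pow_pos (by simp) _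
    · rw [← hC N]
      exact measure_mono (Set.subset_biUnion_of_mem (u := C) (show N ∈ {m | m ≥ N} from le_refl N))
  obtain ⟨g, hg⟩ := hlim
  refine ⟨g, ?_⟩
  have hinf' : {m | g ∈ C m}.Infinite := by
    rw [Set.infinite_iff_exists_gt]
    intro N
    obtain ⟨m, hm, hgm⟩ : ∃ m, N + 1 ≤ m ∧ g ∈ C m := by
      simpa using Set.mem_iInter.1 hg (N + 1)
    exact ⟨m, hgm, hm⟩
  refine (hinf'.image (f := fun m => (e m : ι))
    (Subtype.val_injective.comp e.injective).injOn).mono ?_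
  rintro _ ⟨m, hm, rfl⟩
  exact hF _ _ fun k hk => hm k hk

/-! ### Clique graph spaces and the obstruction. -/

section CliqueSpace

variable {V : Type v} {G : SimpleGraph V}

lemma exists_finset_of_isOpen_cliqueSpace {U : Set (cliqueSpace G)} (hU : IsOpen U)
    {x : cliqueSpace G} (hx : x ∈ U) :
    ∃ F : Finset V, ∀ y : cliqueSpace G, (∀ v ∈ F, y.1 v = x.1 v) → y ∈ U := by
  obtain ⟨W, hW, rfl⟩ := isOpen_induced_iff.1 hU
  obtain ⟨F, hF⟩ := exists_finset_of_isOpen_pi_bool hW hx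
  exact ⟨F, fun y hy => hF y hy⟩

open Classical in
/-- A subset of a clique, given as the part of the clique inside `s`. -/
noncomputable def restrictClique (x : cliqueSpace G) (s : Set V) : cliqueSpace G :=
  ⟨fun v => x.1 v && decide (v ∈ s), fun v hv w hw hvw => x.2 (by
    simp only [Set.mem_ofPred_eq, Bool.and_eq_true] at hv ⊢
    exact hv.1) (by
    simp only [Set.mem_ofPred_eq, Bool.and_eq_true] at hw ⊢
    exact hw.1) hvw⟩

lemma restrictClique_of_mem (x : cliqueSpace G) {s : Set V} {v : V} (hv : v ∈ s) :
    (restrictClique x s).1 v = x.1 v := by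
  simp [restrictClique, hv]

lemma restrictClique_of_notMem (x : cliqueSpace G) {s : Set V} {v : V} (hv : v ∉ s) :
    (restrictClique x s).1 v = false := by
  simp [restrictClique, hv]

/-- The empty clique. -/
def emptyClique (G : SimpleGraph V) : cliqueSpace G :=
  ⟨fun _ => false, fun v hv => by simp at hv⟩

/-- A graph space cannot be covered by open copies of a Cantor cube of uncountable
weight and of the one-point compactification of a discrete space of the same weight. -/
theorem not_homeomorph_cliqueSpace {T : Type*} [TopologicalSpace T] {κ : Type u} [Uncountable κ]
    (c : (κ → Bool) → T) (hc : Continuous c) (hcinj : Function.Injective c)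
    (d : Option κ → T) (hdinj : Function.Injective d)
    (hcover : ∀ t, t ∈ Set.range c ∨ t ∈ Set.range d)
    (hcopen : IsOpen (Set.range c)) (hdopen : IsOpen (Set.range d))
    (hisol : ∀ k, IsOpen {d (some k)}) (h : T ≃ₜ cliqueSpace G) : False := by
  classical
  rcases hcover (h.symm (emptyClique G)) with ⟨f₀, hf₀⟩ | ⟨o₀, ho₀⟩
  · have hemp : emptyClique G ∈ h '' Set.range c := ⟨c f₀, ⟨f₀, rfl⟩, by simp [hf₀]⟩
    obtain ⟨F, hF⟩ := exists_finset_of_isOpen_cliqueSpace (h.isOpenMap _ hcopen) hemp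
    let x : κ → cliqueSpace G := fun k => h (d (some k))
    have hxinj : Function.Injective x := fun a b hab =>
      Option.some_injective _ (hdinj (h.injective hab))
    -- `x k` is isolated, so a finite set `W k` of vertices already determines it. Deleting its
    -- vertices outside `W k` then changes nothing, so `x k` is contained in `W k`.
    have hx : ∀ k, ∃ W : Finset V, ∀ y : cliqueSpace G, (∀ v ∈ W, y.1 v = (x k).1 v) →
        y = x k := by
      intro k
      obtain ⟨W, hW⟩ := exists_finset_of_isOpen_cliqueSpace (x := x k)
        (h.isOpenMap _ (hisol k)) ⟨_, rfl, rfl⟩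
      refine ⟨W, fun y hy => ?_⟩
      obtain ⟨_, rfl, rfl⟩ := hW y hy
      rfl
    choose W hW using hx
    have hxW : ∀ k v, (x k).1 v = true → v ∈ W k := by
      intro k v hv
      by_contra hvW
      have := hW k (restrictClique (x k) (W k)) fun w hw => restrictClique_of_mem _ hw
      rw [← this, restrictClique_of_notMem _ hvW] at hv
      exact Bool.noConfusion hv
    obtain ⟨E, hE⟩ := exists_not_countable_fiber fun k => fun v : F => (x k).1 v
    let S := {k // (fun v : F => (x k).1 v) = E}
    have : Uncountable S := ⟨fun hS => hE (Set.countable_coe_iff.1 hS)⟩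
    have hSF : ∀ (k l : S) (v : V), v ∈ F → (x k).1 v = (x l).1 v := fun k l v hv =>
      congrFun (k.2.trans l.2.symm) ⟨v, hv⟩
    -- `Q k` is `x k` without `F`, hence a clique in the cube part; `U k` collects the points of the
    -- cube whose clique contains `Q k`.
    let Q : S → V → Bool := fun k v => (x k).1 v && decide (v ∉ F)
    let U : S → Set (κ → Bool) := fun k =>
      {f | ∀ v ∈ W k, Q k v = true → (h (c f)).1 v = true}
    have hcont : ∀ v, Continuous fun f => (h (c f)).1 v := fun v =>
      (continuous_apply v).comp (continuous_subtype_val.comp (h.continuous.comp hc))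
    have hU : ∀ k, IsOpen (U k) := by
      intro k
      have : U k = ⋂ v ∈ W k, {f | Q k v = true → (h (c f)).1 v = true} := by
        ext f
        simp [U]
      rw [this]
      refine isOpen_biInter_finset fun v _ => ?_
      by_cases hQ : Q k v = true
      · simp only [hQ, forall_const]
        exact (isOpen_discrete {true}).preimage (hcont v)
      · simp [hQ]
    have hne : ∀ k, (U k).Nonempty := by
      intro k
      obtain ⟨_, ⟨f, rfl⟩, hf⟩ := hF (restrictClique (x k) {v | v ∉ F}) fun v hv =>
        restrictClique_of_notMem _ (by simpa using hv)
      refine ⟨f, fun v _ hv => ?_⟩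
      simp only [Q, Bool.and_eq_true, decide_eq_true_eq] at hv
      rw [hf, restrictClique_of_mem _ hv.2, hv.1]
    obtain ⟨f, hf⟩ := exists_infinite_mem_of_isOpen U hU hne
    have hQf : ∀ k : S, f ∈ U k → ∀ v ∉ F, (x k).1 v = true → (h (c f)).1 v = true := by
      intro k hk v hv hkv
      exact hk v (hxW k v hkv) (by simp [Q, hkv, hv])
    -- The union of infinitely many `x k` is a clique: outside `F` it lies in the clique of `f`, and
    -- inside `F` all the `x k` have the same trace.
    let y : cliqueSpace G := ⟨fun v => decide (∃ k : S, f ∈ U k ∧ (x k).1 v = true), by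
      intro v hv w hw hvw
      simp only [Set.mem_ofPred_eq, decide_eq_true_eq] at hv hw
      obtain ⟨k, hk, hkv⟩ := hv
      obtain ⟨l, hl, hlw⟩ := hw
      by_cases hvF : v ∈ F
      · exact (x l).2 (by rwa [Set.mem_ofPred_eq, hSF l k v hvF]) hlw hvw
      · by_cases hwF : w ∈ F
        · exact (x k).2 hkv (by rwa [Set.mem_ofPred_eq, hSF k l w hwF]) hvw
        · exact (h (c f)).2 (hQf k hk v hvF hkv) (hQf l hl w hwF hlw) hvw⟩
    have hy : ∀ k : S, f ∈ U k → ∀ v, y.1 v = true → v ∈ W k := by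
      intro k hk v hv
      by_contra hvW
      -- Removing from `y` the vertices of `W k` that are not in `x k` leaves a clique with the same
      -- trace on `W k` as `x k`, hence `x k` itself. So `y` has no vertex outside `W k`.
      have := hW k (restrictClique y {v | v ∈ W k → (x k).1 v = true}) (by
        intro w hw
        by_cases hkw : (x k).1 w = true
        · rw [restrictClique_of_mem _ (by simp [hkw]), hkw]
          simp only [y, decide_eq_true_eq]
          exact ⟨k, hk, hkw⟩
        · rw [restrictClique_of_notMem _ (by simp [hkw, hw])]
          simpa using hkw)
      apply hvW
      apply hxW k v
      rw [← this, restrictClique_of_mem _ (by simp [hvW]), hv]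
    obtain ⟨k, hk⟩ := hf.nonempty
    have hxy : ∀ l : S, f ∈ U l → ∀ v, (x l).1 v = true → v ∈ W k := by
      intro l hl v hv
      refine hy k hk v ?_
      simp only [y, decide_eq_true_eq]
      exact ⟨l, hl, hv⟩
    -- Infinitely many distinct `x l` would be subsets of the finite set `W k`.
    refine hf (Set.Finite.of_finite_image (f := fun l : S => fun v : W k => (x l).1 v)
      (Set.toFinite _) ?_)
    intro l hl m hm hlm
    refine Subtype.ext (hxinj (Subtype.ext (funext fun v => ?_)))
    by_cases hv : v ∈ W k
    · exact congrFun hlm ⟨v, hv⟩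
    · rw [Bool.eq_false_iff.2 fun h => hv (hxy l hl v h),
        Bool.eq_false_iff.2 fun h => hv (hxy m hm v h)]
  · have hemp : emptyClique G ∈ h '' Set.range d := ⟨d o₀, ⟨o₀, rfl⟩, by simp [ho₀]⟩
    obtain ⟨F, hF⟩ := exists_finset_of_isOpen_cliqueSpace (h.isOpenMap _ hdopen) hemp
    have hex : ∀ f, ∃ o, h (d o) = restrictClique (h (c f)) {v | v ∉ F} := by
      intro f
      obtain ⟨_, ⟨o, rfl⟩, ho⟩ := hF (restrictClique (h (c f)) {v | v ∉ F}) fun v hv =>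
        restrictClique_of_notMem _ (by simpa using hv)
      exact ⟨o, ho⟩
    choose o ho using hex
    obtain ⟨e⟩ : Nonempty ((F → Bool) ↪ ℕ) := ⟨(Finite.equivFin _).toEmbedding.trans Fin.valEmbedding⟩
    -- A clique is determined by its part outside `F`, coded by `o f`, and its trace on `F`. This
    -- would give `2 ^ κ ≤ κ`.
    have hinj : Function.Injective fun f => (o f, e fun v => (h (c f)).1 v) := by
      intro f g hfg
      simp only [Prod.mk.injEq, EmbeddingLike.apply_eq_iff_eq] at hfg
      refine hcinj (h.injective (Subtype.ext (funext fun v => ?_)))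
      by_cases hv : v ∈ F
      · exact congrFun hfg.2 ⟨v, hv⟩
      · have h1 := ho f
        rw [hfg.1, ho g] at h1
        rw [← restrictClique_of_mem (h (c f)) (s := {v | v ∉ F}) hv, ← h1,
          restrictClique_of_mem _ hv]
    have hcard := Cardinal.mk_le_of_injective hinj
    have hκ : Cardinal.aleph0 ≤ Cardinal.mk κ := Cardinal.aleph0_le_mk κ
    have h1 : Cardinal.mk (Option κ × ℕ) = Cardinal.mk κ := by
      rw [Cardinal.mk_prod, Cardinal.mk_option, Cardinal.add_one_eq hκ]
      simp [Cardinal.mul_aleph0_eq hκ]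
    rw [h1] at hcard
    refine absurd hcard (not_le.2 ?_)
    simpa using Cardinal.cantor (Cardinal.mk κ)

end CliqueSpace

/-! ### The finite-cofinite algebra. -/

section FinCo

variable {κ : Type u}

/-- A singleton as an element of the finite-cofinite algebra. -/
def FinCo.singleton (k : κ) : FinCo κ := ⟨{k}, Or.inl (Set.finite_singleton k)⟩

@[simp] lemma FinCo.val_singleton (k : κ) : (FinCo.singleton k : Set κ) = {k} := rfl

/-- The ultrafilter of the finite-cofinite algebra induced by an ultrafilter on `κ`. -/
def FinCo.ult (F : Ultrafilter κ) : Ult (FinCo κ) :=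
  (Ult.ofUltrafilter F).comap (FinCo κ).subtype

@[simp] lemma FinCo.mem_ult {F : Ultrafilter κ} {s : FinCo κ} :
    s ∈ (FinCo.ult F).carrier ↔ (s : Set κ) ∈ F := Iff.rfl

lemma FinCo.mem_of_finite {L : BooleanSubalgebra (FinCo κ)} (hL : ∀ k, FinCo.singleton k ∈ L)
    {s : Set κ} (hs : s.Finite) (hs' : s ∈ FinCo κ) : (⟨s, hs'⟩ : FinCo κ) ∈ L := by
  induction s, hs using Set.Finite.induction_on with
  | empty => exact L.bot_mem
  | @insert a t _ ht ih =>
    exact L.sup_mem (hL a) (ih (Or.inl ht))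

lemma FinCo.closure_range_singleton :
    BooleanSubalgebra.closure (Set.range (FinCo.singleton : κ → FinCo κ)) = ⊤ := by
  refine eq_top_iff.2 fun s _ => ?_
  have h := fun k => BooleanSubalgebra.subset_closure
    (Set.mem_range_self (f := (FinCo.singleton : κ → FinCo κ)) k)
  obtain ⟨s, hs | hs⟩ := s
  · exact FinCo.mem_of_finite h hs _
  · rw [← BooleanSubalgebra.compl_mem_iff]
    exact FinCo.mem_of_finite h hs _

lemma FinCo.singleton_notMem_hyperfilter [Infinite κ] (k : κ) :
    ({k} : Set κ) ∉ Filter.hyperfilter κ :=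
  (Set.finite_singleton k).notMem_hyperfilter

lemma FinCo.ult_cases [Infinite κ] (p : Ult (FinCo κ)) :
    p = FinCo.ult (Filter.hyperfilter κ) ∨ ∃ k, p = FinCo.ult (pure k) := by
  by_cases h : ∃ k, FinCo.singleton k ∈ p.carrier
  · obtain ⟨k, hk⟩ := h
    refine Or.inr ⟨k, (Ult.eq_of_subset fun s hs => ?_).symm⟩
    refine p.mem_of_le _ hk _ ?_
    exact Set.singleton_subset_iff.2 hs
  · refine Or.inl (Ult.ext_of_closure FinCo.closure_range_singleton ?_)
    rintro _ ⟨k, rfl⟩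
    simp only [FinCo.mem_ult, FinCo.val_singleton, FinCo.singleton_notMem_hyperfilter, iff_false]
    exact fun hk => h ⟨k, hk⟩

/-- A pairwise meeting set of singletons has at most one member; the empty set is the trace of the
point at infinity. -/
theorem FinCo.isTwoGenerating [Infinite κ] :
    IsTwoGenerating (Set.range (FinCo.singleton : κ → FinCo κ)) := by
  refine ⟨FinCo.closure_range_singleton, fun K hK hK' => ?_⟩
  by_cases h : ∃ k, FinCo.singleton k ∈ K
  · obtain ⟨k, hk⟩ := h
    refine ⟨FinCo.ult (pure k), ?_⟩
    rintro _ ⟨l, rfl⟩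
    simp only [FinCo.mem_ult, FinCo.val_singleton, Ultrafilter.mem_pure, Set.mem_singleton_iff]
    refine ⟨fun h => h ▸ hk, fun hl => ?_⟩
    by_contra hne
    refine hK' _ hk _ hl (Subtype.ext ?_)
    exact Set.singleton_inter_eq_empty.2 hne
  · refine ⟨FinCo.ult (Filter.hyperfilter κ), ?_⟩
    rintro _ ⟨l, rfl⟩
    simp only [FinCo.mem_ult, FinCo.val_singleton, FinCo.singleton_notMem_hyperfilter,
      false_iff]
    exact fun hl => h ⟨l, hl⟩

end FinCo

/-! ### The free Boolean algebra. -/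

section Fr

variable {κ : Type u}

/-- The free generators of `Fr κ`. -/
def Fr.gen (k : κ) : Fr κ :=
  ⟨{f | f k = true}, BooleanSubalgebra.subset_closure ⟨k, rfl⟩⟩

/-- The ultrafilter of `Fr κ` given by a point of the Cantor cube. -/
def Fr.ult (f : κ → Bool) : Ult (Fr κ) := (Ult.ofUltrafilter (pure f)).comap (Fr κ).subtype

lemma Fr.gen_mem_ult {f : κ → Bool} {k : κ} :
    Fr.gen k ∈ (Fr.ult f).carrier ↔ f k = true := Iff.rfl

lemma Fr.closure_range_gen :
    BooleanSubalgebra.closure (Set.range (Fr.gen : κ → Fr κ)) = ⊤ := by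
  refine eq_top_iff.2 fun s _ => ?_
  obtain ⟨s, hs⟩ := s
  have hs' := hs
  induction hs' using BooleanSubalgebra.closure_bot_sup_induction with
  | mem x hx =>
    obtain ⟨k, rfl⟩ := hx
    exact BooleanSubalgebra.subset_closure ⟨k, rfl⟩
  | bot => exact BooleanSubalgebra.bot_mem
  | sup x hx y hy ihx ihy => exact BooleanSubalgebra.sup_mem (ihx hx trivial) (ihy hy trivial)
  | compl x hx ih => exact BooleanSubalgebra.compl_mem (ih hx trivial)

lemma Fr.ult_surjective : Function.Surjective (Fr.ult : (κ → Bool) → Ult (Fr κ)) := by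
  classical
  intro p
  refine ⟨fun k => decide (Fr.gen k ∈ p.carrier), Ult.ext_of_closure Fr.closure_range_gen ?_⟩
  rintro _ ⟨k, rfl⟩
  rw [Fr.gen_mem_ult, decide_eq_true_eq]

/-- By independence every set of generators is a trace, namely that of the point of the cube it
describes. -/
theorem Fr.isTwoGenerating : IsTwoGenerating (Set.range (Fr.gen : κ → Fr κ)) := by
  classical
  refine ⟨Fr.closure_range_gen, fun K _ _ => ⟨Fr.ult fun k => decide (Fr.gen k ∈ K), ?_⟩⟩
  rintro _ ⟨k, rfl⟩
  rw [Fr.gen_mem_ult, decide_eq_true_eq]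

lemma Fr.isClopen (s : Fr κ) : IsClopen (s : Set (κ → Bool)) := by
  obtain ⟨s, hs⟩ := s
  induction hs using BooleanSubalgebra.closure_bot_sup_induction with
  | mem x hx =>
    obtain ⟨k, rfl⟩ := hx
    exact (isClopen_discrete {true}).preimage (continuous_apply k)
  | bot => exact isClopen_empty
  | sup x _ y _ hx hy => exact hx.union hy
  | compl x _ hx => exact hx.compl

end Fr

/-! ### Ultrafilters of a product. -/

section Prod

variable {A : Type u} {B : Type v} [BooleanAlgebra A] [BooleanAlgebra B]

lemma Ult.exists_eq_comap_prodFst {p : Ult (A × B)} (hp : (⊤, ⊥) ∈ p.carrier) :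
    ∃ q : Ult A, p = q.comap BoundedLatticeHom.prodFst := by
  refine ⟨⟨{a | (a, ⊥) ∈ p.carrier}, hp, p.bot_notMem, fun a ha b hb => ?_,
    fun a ha b hab => p.mem_of_le _ ha _ ⟨hab, le_rfl⟩, fun a => ?_⟩,
    Ult.eq_of_subset fun x hx => ?_⟩
  · simpa using p.inf_mem _ ha _ hb
  · rw [Set.mem_ofPred_eq, Set.mem_ofPred_eq, ← p.sup_mem_iff]
    simpa using hp
  · exact p.mem_of_le _ (p.inf_mem _ hx _ hp) _ ⟨inf_le_left, inf_le_right⟩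

lemma Ult.exists_eq_comap_prodSnd {p : Ult (A × B)} (hp : (⊥, ⊤) ∈ p.carrier) :
    ∃ q : Ult B, p = q.comap BoundedLatticeHom.prodSnd := by
  refine ⟨⟨{b | (⊥, b) ∈ p.carrier}, hp, p.bot_notMem, fun a ha b hb => ?_,
    fun a ha b hab => p.mem_of_le _ ha _ ⟨le_rfl, hab⟩, fun a => ?_⟩,
    Ult.eq_of_subset fun x hx => ?_⟩
  · simpa using p.inf_mem _ ha _ hb
  · rw [Set.mem_ofPred_eq, Set.mem_ofPred_eq, ← p.sup_mem_iff]
    simpa using hp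
  · exact p.mem_of_le _ (p.inf_mem _ hx _ hp) _ ⟨inf_le_right, inf_le_left⟩

lemma Ult.mem_left_or_right (p : Ult (A × B)) :
    (⊥, ⊤) ∈ p.carrier ∨ (⊤, ⊥) ∈ p.carrier := by
  rw [← p.sup_mem_iff]
  simpa using! p.top_mem

end Prod

/-! ### The dual space of the product and the main theorem. -/

theorem not_isGraphSpace_ult_finCo_prod_fr {κ : Type u} [Uncountable κ] :
    ¬ IsGraphSpace.{u, v} (Ult (FinCo κ × Fr κ)) := by
  rintro ⟨V, G, ⟨h⟩⟩
  let c : (κ → Bool) → Ult (FinCo κ × Fr κ) := fun f =>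
    (Fr.ult f).comap BoundedLatticeHom.prodSnd
  -- `none` is the point at infinity: on finite and cofinite sets the hyperfilter contains exactly
  -- the cofinite ones.
  let d : Option κ → Ult (FinCo κ × Fr κ) := fun o =>
    (FinCo.ult (o.elim (Filter.hyperfilter κ) pure)).comap BoundedLatticeHom.prodFst
  have hc_mem : ∀ f (x : FinCo κ × Fr κ), x ∈ (c f).carrier ↔ f ∈ (x.2 : Set (κ → Bool)) :=
    fun f x => Iff.rfl
  have hd_mem : ∀ o (x : FinCo κ × Fr κ), x ∈ (d o).carrier ↔
      (x.1 : Set κ) ∈ (o.elim (Filter.hyperfilter κ) pure : Ultrafilter κ) :=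
    fun o x => Iff.rfl
  have hrc : ∀ p, (⊥, ⊤) ∈ p.carrier → p ∈ Set.range c := by
    intro p hp
    obtain ⟨q, rfl⟩ := Ult.exists_eq_comap_prodSnd hp
    obtain ⟨f, rfl⟩ := Fr.ult_surjective q
    exact ⟨f, rfl⟩
  have hrd : ∀ p, (⊤, ⊥) ∈ p.carrier → p ∈ Set.range d := by
    intro p hp
    obtain ⟨q, rfl⟩ := Ult.exists_eq_comap_prodFst hp
    obtain rfl | ⟨k, rfl⟩ := FinCo.ult_cases q
    · exact ⟨none, rfl⟩
    · exact ⟨some k, rfl⟩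
  have hcr : Set.range c = {p | (⊥, ⊤) ∈ p.carrier} := by
    refine Set.Subset.antisymm ?_ hrc
    rintro _ ⟨f, rfl⟩
    exact (hc_mem _ _).2 (Set.mem_univ f)
  have hdr : Set.range d = {p | (⊤, ⊥) ∈ p.carrier} := by
    refine Set.Subset.antisymm ?_ hrd
    rintro _ ⟨o, rfl⟩
    exact (hd_mem _ _).2 Filter.univ_mem
  have hdsome : ∀ k o, (FinCo.singleton k, (⊥ : Fr κ)) ∈ (d o).carrier ↔ o = some k := by
    intro k o
    rw [hd_mem]
    cases o with
    | none => simp [FinCo.singleton_notMem_hyperfilter]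
    | some l => simp
  refine not_homeomorph_cliqueSpace c ?_ ?_ d ?_ ?_ ?_ ?_ ?_ h
  · refine continuous_generateFrom_iff.2 ?_
    rintro _ ⟨x, rfl⟩
    exact (Fr.isClopen x.2).isOpen
  · intro f g hfg
    funext k
    have h1 : (⊥, Fr.gen k) ∈ (c f).carrier ↔ (⊥, Fr.gen k) ∈ (c g).carrier := by rw [hfg]
    rw [hc_mem, hc_mem] at h1
    exact Bool.eq_iff_iff.2 h1
  · intro o o' hoo'
    have h1 : ∀ k, o = some k ↔ o' = some k := fun k => by
      rw [← hdsome k o, ← hdsome k o', hoo']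
    exact Option.ext h1
  · exact fun t => t.mem_left_or_right.imp (hrc t) (hrd t)
  · rw [hcr]
    exact Ult.isOpen_mem _
  · rw [hdr]
    exact Ult.isOpen_mem _
  · intro k
    have : {d (some k)} = {p : Ult (FinCo κ × Fr κ) | (FinCo.singleton k, ⊥) ∈ p.carrier} := by
      ext p
      refine ⟨?_, fun hp => ?_⟩
      · rintro rfl
        exact (hdsome k _).2 rfl
      · obtain ⟨o, rfl⟩ := hrd p (p.mem_of_le _ hp _ ⟨le_top, le_rfl⟩)
        rw [(hdsome k o).1 hp]
        rfl
    rw [this]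
    exact Ult.isOpen_mem _

instance : Uncountable (ω₁ : Ordinal.{u}).ToType := by
  rw [← Cardinal.aleph0_lt_mk_iff, Cardinal.mk_toType, Ordinal.card_omega]
  exact Cardinal.aleph0_lt_aleph_one

theorem mainTheorem6 :
    IsNFree.{u, v} 2 (FinCo (ω₁ : Ordinal.{u}).ToType) ∧
    IsNFree.{u, v} 2 (Fr (ω₁ : Ordinal.{u}).ToType) ∧
    ¬ IsNFree.{u, v} 2 (FinCo (ω₁ : Ordinal.{u}).ToType × Fr (ω₁ : Ordinal.{u}).ToType) ∧
    IsSupercompact (Ult (FinCo (ω₁ : Ordinal.{u}).ToType × Fr (ω₁ : Ordinal.{u}).ToType)) ∧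
    ¬ IsGraphSpace.{u, v}
      (Ult (FinCo (ω₁ : Ordinal.{u}).ToType × Fr (ω₁ : Ordinal.{u}).ToType)) := by
  have hsc := FinCo.isTwoGenerating.isSupercompact_prod
    (Fr.isTwoGenerating (κ := (ω₁ : Ordinal.{u}).ToType))
    (X := Set.range (FinCo.singleton (κ := (ω₁ : Ordinal.{u}).ToType)))
  have := hsc.compactSpace
  exact ⟨⟨_, FinCo.isTwoGenerating.isNFreeOver⟩, ⟨_, Fr.isTwoGenerating.isNFreeOver⟩,
    fun h => not_isGraphSpace_ult_finCo_prod_fr h.isGraphSpace, hsc,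
    not_isGraphSpace_ult_finCo_prod_fr⟩
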